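/- Let $(X,d)$ be a Polish metric space, i.e. a complete separable metric space, equipped with its Borel $\sigma$-algebra, and let $p\in[1,\infty)$. Let $$\mathcal P_p(X)=\Big\{\mu \text{ a Borel probability measure on } X : \int_X d(x_0,x)^p\,d\mu(x)<\infty\Big\}\qquad(x_0\in X\text{ arbitrary}),$$ with the Wasserstein distance $$\mathcal W_p(\mu,\nu)=\Big(\inf_{\gamma\in\Pi(\mu,\nu)}\int_{X^2} d(x,y)^p\,d\gamma(x,y)\Big)^{1/p},$$ where $\Pi(\mu,\nu)$ is the set of probability measures on $X^2$ with first marginal $\mu$ and second marginal $\nu$. Equip $\mathcal P_p(X)$ with the Borel $\sigma$-algebra of the topology of $\mathcal W_p$, and let $\mathcal P_p(\mathcal P_p(X))$ be the set of probability measures $\varphi$ on $\mathcal P_p(X)$ with $\int_{\mathcal P_p(X)}\mathcal W_p(\rho_0,\rho)^p\,d\varphi(\rho)<\infty$ ($\rho_0\in\mathcal P_p(X)$ arbitrary). For $\varphi,\psi\in\mathcal P_p(\mathcal P_p(X))$ define the hierarchical Wasserstein distance of order $p$ by $$\mathcal{HW}_p(\varphi,\psi)=\Big(\inf_{\eta\in\Pi(\varphi,\psi)}\int_{\mathcal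 P_p(X)^2}\mathcal W_p(\rho,\sigma)^p\,d\eta(\rho,\sigma)\Big)^{1/p}.$$ Then $\mathcal{HW}_p$ is a (finite) metric on $\mathcal P_p(\mathcal P_p(X))$, and $(\mathcal P_p(\mathcal P_p(X)),\mathcal{HW}_p)$ is a Polish metric space, i.e. complete and separable. -/

import Mathlib

open MeasureTheory
open scoped ENNReal

noncomputable section

namespace HierarchicalOT

/-- The topology of an (extended) distance function: `s` is open iff around each of its points it
contains a ball. No axiom of a metric is needed to define it. -/
@[reducible] def edistTopology (α : Type*) [EDist α] : TopologicalSpace α where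
  IsOpen s := ∀ x ∈ s, ∃ ε : ℝ≥0∞, 0 < ε ∧ ∀ y, edist y x < ε → y ∈ s
  isOpen_univ := fun _ _ => ⟨1, one_pos, fun _ _ => trivial⟩
  isOpen_inter := by
    intro s t hs ht x hx
    obtain ⟨ε, hε, h⟩ := hs x hx.1
    obtain ⟨δ, hδ, h'⟩ := ht x hx.2
    exact ⟨min ε δ, lt_min hε hδ, fun y hy =>
      ⟨h y (lt_of_lt_of_le hy (min_le_left _ _)), h' y (lt_of_lt_of_le hy (min_le_right _ _))⟩⟩
  isOpen_sUnion := by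
    intro S hS x hx
    obtain ⟨s, hs, hxs⟩ := hx
    obtain ⟨ε, hε, h⟩ := hS s hs x hxs
    exact ⟨ε, hε, fun y hy => ⟨s, hs, h y hy⟩⟩

/-- For a genuine (extended pseudo-)metric, `edistTopology` is the usual metric topology. -/
theorem edistTopology_eq (α : Type*) [PseudoEMetricSpace α] :
    edistTopology α = (inferInstance : TopologicalSpace α) := by
  ext s
  exact (EMetric.isOpen_iff (s := s)).symm

/-- The set `Π(μ, ν)` of transport plans: probability measures on `X × X` with marginals
`μ` and `ν`. -/
def transportPlans {X : Type*} [MeasurableSpace X] (μ ν : ProbabilityMeasure X) :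
    Set (ProbabilityMeasure (X × X)) :=
  {γ | (γ : Measure (X × X)).map Prod.fst = (μ : Measure X) ∧
       (γ : Measure (X × X)).map Prod.snd = (ν : Measure X)}

/-- The Wasserstein space `𝒫_p(X)`: probability measures on `X` with finite moment of order `p`. -/
@[ext]
structure WassersteinSpace (X : Type*) [EDist X] [MeasurableSpace X] (p : ℝ) where
  toProb : ProbabilityMeasure X
  finite_moment : ∀ x₀ : X, ∫⁻ x, edist x₀ x ^ p ∂(toProb : Measure X) < ∞

/-- The Wasserstein distance
`W_p(μ, ν) = (inf_{γ ∈ Π(μ, ν)} ∫ d(x, y)^p dγ(x, y))^{1/p}`, a priori with values in `[0, ∞]`. -/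
def wassersteinDist {X : Type*} [EDist X] [MeasurableSpace X] {p : ℝ}
    (μ ν : WassersteinSpace X p) : ℝ≥0∞ :=
  (⨅ γ ∈ transportPlans μ.toProb ν.toProb,
    ∫⁻ z, edist z.1 z.2 ^ p ∂(γ : Measure (X × X))) ^ (1 / p)

/-- The Wasserstein space carries the Wasserstein distance ... -/
instance instEDistWassersteinSpace (X : Type*) [EDist X] [MeasurableSpace X] (p : ℝ) : EDist (WassersteinSpace X p) where
  edist := wassersteinDist

/-- ... and the Borel σ-algebra of the topology of that distance. -/
instance instMeasurableSpaceWassersteinSpace (X : Type*) [EDist X] [MeasurableSpace X] (p : ℝ) :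
    MeasurableSpace (WassersteinSpace X p) :=
  @borel (WassersteinSpace X p) (edistTopology (WassersteinSpace X p))

/-- The space `𝒫_p(𝒫_p(X))`, where `𝒫_p(X)` carries the distance `W_p`. -/
abbrev HierarchicalWassersteinSpace (X : Type*) [EDist X] [MeasurableSpace X] (p : ℝ) :=
  WassersteinSpace (WassersteinSpace X p) p

/-- The hierarchical Wasserstein distance
`HW_p(φ, ψ) = (inf_{η ∈ Π(φ, ψ)} ∫ W_p(ρ, σ)^p dη(ρ, σ))^{1/p}`, a priori with values in
`[0, ∞]`. -/
def hierarchicalWassersteinDist {X : Type*} [EDist X] [MeasurableSpace X] {p : ℝ}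
    (φ ψ : HierarchicalWassersteinSpace X p) : ℝ≥0∞ :=
  (⨅ η ∈ transportPlans φ.toProb ψ.toProb,
    ∫⁻ z, wassersteinDist z.1 z.2 ^ p
      ∂(η : Measure (WassersteinSpace X p × WassersteinSpace X p))) ^ (1 / p)

/-- `(α, D)` is a Polish metric space: `D` is a (finite) metric on `α`, and `α` is complete and
separable for `D`. -/
def IsPolishMetric {α : Type*} (D : α → α → ℝ≥0∞) : Prop :=
  ∃ _ : MetricSpace α, (∀ x y : α, D x y = ENNReal.ofReal (dist x y)) ∧
    CompleteSpace α ∧ TopologicalSpace.SeparableSpace α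

end HierarchicalOT

end

/-! It suffices that the Wasserstein space of a Polish metric space is again Polish:
`hierarchicalWassersteinDist` is `wassersteinDist` over `WassersteinSpace X p`, so this result is
applied twice.

Measures are realised as random variables on one probability space, and every coupling bounds the
Wasserstein distance from above (`wassersteinDist_le_lpEDist`). Conversely, gluing chains of almost
optimal plans (`exists_process_of_chain`) realises a whole sequence of measures with controlled
consecutive `L^p`-distances. Minkowski's inequality then gives the triangle inequality, and almost
sure convergence with Fatou gives completeness. Separability is inherited from an `L^p` space over
the unit interval. No optimal plan is ever needed. -/

namespace HierarchicalOT

open ProbabilityTheory TopologicalSpace Filter Topology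

/-- The `L^p`-distance between two random variables with values in `X`. -/
noncomputable def lpEDist {X Ω : Type*} [EDist X] [MeasurableSpace Ω] (p : ℝ) (P : Measure Ω)
    (f g : Ω → X) : ℝ≥0∞ :=
  (∫⁻ ω, edist (f ω) (g ω) ^ p ∂P) ^ (1 / p)

/-! ### The `L^p`-distance of random variables. -/

section Basic

variable {X Ω : Type*} [PseudoEMetricSpace X] [MeasurableSpace Ω] {P : Measure Ω} {p : ℝ}
  {f g : Ω → X}

theorem lpEDist_comm (f g : Ω → X) : lpEDist p P f g = lpEDist p P g f := by
  simp only [lpEDist, edist_comm]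

theorem lpEDist_self (hp : 1 ≤ p) (f : Ω → X) : lpEDist p P f f = 0 := by
  have : 0 < p := by linarith
  simp [lpEDist, this]

theorem lpEDist_lt_iff (hp : 1 ≤ p) {c : ℝ≥0∞} :
    lpEDist p P f g < c ↔ ∫⁻ ω, edist (f ω) (g ω) ^ p ∂P < c ^ p := by
  rw [lpEDist, one_div, ENNReal.rpow_inv_lt_iff (by linarith)]

theorem lpEDist_le_iff (hp : 1 ≤ p) {c : ℝ≥0∞} :
    lpEDist p P f g ≤ c ↔ ∫⁻ ω, edist (f ω) (g ω) ^ p ∂P ≤ c ^ p := by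
  rw [lpEDist, one_div, ENNReal.rpow_inv_le_iff (by linarith)]

theorem lpEDist_lt_top_iff (hp : 1 ≤ p) :
    lpEDist p P f g < ∞ ↔ ∫⁻ ω, edist (f ω) (g ω) ^ p ∂P < ∞ := by
  rw [lpEDist_lt_iff hp, ENNReal.top_rpow_of_pos (by linarith)]

end Basic

section LpEDist

variable {X Ω : Type*} [MetricSpace X] [SecondCountableTopology X] [MeasurableSpace X]
  [BorelSpace X] [MeasurableSpace Ω] {P : Measure Ω} {p : ℝ} {f g h : Ω → X}

theorem lpEDist_triangle (hp : 1 ≤ p) (hf : Measurable f) (hg : Measurable g)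
    (hh : Measurable h) : lpEDist p P f h ≤ lpEDist p P f g + lpEDist p P g h := by
  refine le_trans ?_ (ENNReal.lintegral_Lp_add_le (μ := P) (p := p)
    (hf.edist hg).aemeasurable (hg.edist hh).aemeasurable hp)
  have : 0 ≤ p := by linarith
  unfold lpEDist
  gcongr
  exact edist_triangle _ _ _

theorem lpEDist_map {Ω' : Type*} [MeasurableSpace Ω'] {T : Ω' → Ω} {Q : Measure Ω'}
    (hT : Measurable T) (hf : Measurable f) (hg : Measurable g) :
    lpEDist p (Q.map T) f g = lpEDist p Q (f ∘ T) (g ∘ T) := by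
  unfold lpEDist
  rw [lintegral_map ((hf.edist hg).pow_const p) hT]
  rfl

/-- Monotonicity of `L^p`-norms in the exponent; makes the increments of a process summable in mean.
-/
theorem lintegral_edist_le_lpEDist [IsProbabilityMeasure P] (hp : 1 ≤ p) (hf : Measurable f)
    (hg : Measurable g) : ∫⁻ ω, edist (f ω) (g ω) ∂P ≤ lpEDist p P f g := by
  have h := eLpNorm'_le_eLpNorm'_of_exponent_le (μ := P) one_pos hp
    (f := fun ω => edist (f ω) (g ω)) (hf.edist hg).aestronglyMeasurable
  simpa [eLpNorm', lpEDist] using h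

theorem measure_le_edist_le (hp : 1 ≤ p) (hf : Measurable f) (hg : Measurable g) {ε : ℝ≥0∞}
    (hε : ε ≠ 0) (hε' : ε ≠ ∞) :
    P {ω | ε ≤ edist (f ω) (g ω)} ≤ (∫⁻ ω, edist (f ω) (g ω) ^ p ∂P) / ε ^ p := by
  have hp' : 0 < p := by linarith
  refine le_trans (measure_mono fun ω hω => ?_) (meas_ge_le_lintegral_div
    ((hf.edist hg).pow_const p).aemeasurable (ε := ε ^ p) ?_ ?_)
  · exact ENNReal.rpow_le_rpow hω hp'.le
  · simp [ENNReal.rpow_eq_zero_iff, hε, hε']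
  · simp [ENNReal.rpow_eq_top_iff, hε, hε', hp'.not_gt]

/-- Fatou's lemma for the `L^p`-distance. -/
theorem lpEDist_le_of_tendsto (hp : 1 ≤ p) {u : ℕ → Ω → X} (hu : ∀ n, Measurable (u n))
    (hf : Measurable f) (hlim : ∀ᵐ ω ∂P, Tendsto (fun n => u n ω) atTop (𝓝 (g ω)))
    {c : ℝ≥0∞} (hc : ∀ᶠ n in atTop, lpEDist p P f (u n) ≤ c) : lpEDist p P f g ≤ c := by
  rw [lpEDist_le_iff hp]
  calc ∫⁻ ω, edist (f ω) (g ω) ^ p ∂P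
      = ∫⁻ ω, liminf (fun n => edist (f ω) (u n ω) ^ p) atTop ∂P := by
        refine lintegral_congr_ae ?_
        filter_upwards [hlim] with ω hω
        exact (((ENNReal.continuous_rpow_const.tendsto _).comp
          (tendsto_const_nhds.edist hω)).liminf_eq).symm
    _ ≤ liminf (fun n => ∫⁻ ω, edist (f ω) (u n ω) ^ p ∂P) atTop :=
        lintegral_liminf_le fun n => (hf.edist (hu n)).pow_const p
    _ ≤ c ^ p := by
        refine liminf_le_of_frequently_le' (Eventually.frequently ?_)
        filter_upwards [hc] with n hn
        exact (lpEDist_le_iff hp).1 hn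

end LpEDist

/-! ### Gluing of transport plans. -/

section Chain

theorem _root_.MeasureTheory.Measure.map_compProd {α β δ : Type*} [MeasurableSpace α]
    [MeasurableSpace β] [MeasurableSpace δ] (μ : Measure α) [SFinite μ] (κ : Kernel β δ)
    [IsSFiniteKernel κ] {f : α → β} (hf : Measurable f) :
    (μ.map f).compProd κ = (μ.compProd (κ.comap f hf)).map (Prod.map f id) := by
  refine Measure.ext_of_lintegral _ fun g hg => ?_
  rw [Measure.lintegral_compProd hg, lintegral_map hg (by fun_prop),
    Measure.lintegral_compProd (by fun_prop), lintegral_map (by fun_prop) hf]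
  rfl

variable {X : Type*} [MeasurableSpace X] [StandardBorelSpace X]

/-- Gluing of a chain of transport plans: if the second marginal of `γ n` is the first marginal of
`γ (n + 1)`, then there is a process whose consecutive pairs have the laws `γ n`. -/
theorem exists_process_of_chain (γ : ℕ → Measure (X × X)) [∀ n, IsProbabilityMeasure (γ n)]
    (hγ : ∀ n, (γ n).snd = (γ (n + 1)).fst) :
    ∃ P : Measure (ℕ → X), IsProbabilityMeasure P ∧
      ∀ n, P.map (fun x => (x n, x (n + 1))) = γ n := by
  have : Nonempty X := (nonempty_of_isProbabilityMeasure (γ 0)).map Prod.fst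
  have hev (n : ℕ) : Measurable fun x : (i : Finset.Iic n) → X => x ⟨n, by simp⟩ :=
    measurable_pi_apply _
  -- Markov chain: the next point depends on the past only through the last coordinate, by
  -- disintegration of `γ n`.
  let κ : (n : ℕ) → Kernel ((i : Finset.Iic n) → X) X := fun n =>
    (γ n).condKernel.comap (fun x => x ⟨n, by simp⟩) (hev n)
  have (n : ℕ) : IsMarkovKernel (κ n) := by dsimp only [κ]; infer_instance
  let P : Measure (ℕ → X) := Kernel.trajMeasure (X := fun _ => X) (γ 0).fst κ
  have hP : IsProbabilityMeasure P := by dsimp only [P]; infer_instance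
  have hr (n : ℕ) : Measurable (Preorder.frestrictLe (π := fun _ => X) n) := by fun_prop
  have step (n : ℕ) (hn : P.map (fun x => x n) = (γ n).fst) :
      P.map (fun x => (x n, x (n + 1))) = γ n := by
    have h := Kernel.map_frestrictLe_trajMeasure_compProd_eq_map_trajMeasure (X := fun _ => X)
      (μ₀ := (γ 0).fst) (κ := κ) (a := n)
    have h2 : P.map (fun x => x n) = (P.map (Preorder.frestrictLe n)).map
        fun x : (i : Finset.Iic n) → X => x ⟨n, by simp⟩ := by
      rw [Measure.map_map (hev n) (hr n)]; rfl
    conv_rhs => rw [← (γ n).disintegrate (γ n).condKernel, ← hn, h2]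
    rw [Measure.map_compProd _ _ (hev n)]
    refine Eq.trans ?_ (congrArg (Measure.map _) h.symm)
    rw [Measure.map_map (by fun_prop) (by fun_prop)]
    rfl
  have zero : P.map (fun x => x 0) = (γ 0).fst := by
    have h2 : P.map (fun x => x 0) = (P.map (Preorder.frestrictLe 0)).map
        fun x : (i : Finset.Iic 0) → X => x ⟨0, by simp⟩ := by
      rw [Measure.map_map (hev 0) (hr 0)]; rfl
    rw [h2]
    dsimp only [P]
    rw [Kernel.trajMeasure, Measure.map_comp _ _ (hr 0), Kernel.traj_map_frestrictLe,
      Kernel.partialTraj_self, Measure.id_comp, Measure.map_map (hev 0) (by fun_prop)]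
    exact Measure.map_id
  refine ⟨P, hP, fun n => step n ?_⟩
  induction n with
  | zero => exact zero
  | succ n ih =>
    rw [← hγ n, ← step n ih, Measure.snd, Measure.map_map measurable_snd (by fun_prop)]
    rfl

end Chain

theorem exists_plan_of_wassersteinDist_lt {X : Type*} [PseudoEMetricSpace X] [MeasurableSpace X]
    {p : ℝ} (hp : 1 ≤ p) {μ ν : WassersteinSpace X p} {c : ℝ≥0∞}
    (h : wassersteinDist μ ν < c) :
    ∃ γ : Measure (X × X), IsProbabilityMeasure γ ∧ γ.fst = μ.toProb ∧ γ.snd = ν.toProb ∧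
      lpEDist p γ Prod.fst Prod.snd < c := by
  rw [wassersteinDist, one_div, ENNReal.rpow_inv_lt_iff (by linarith)] at h
  obtain ⟨γ, hγ, h⟩ := by simpa only [iInf_lt_iff] using h
  exact ⟨γ, γ.2, hγ.1, hγ.2, (lpEDist_lt_iff hp).2 h⟩

/-! ### Finiteness, symmetry and definiteness of the Wasserstein distance. -/

section Wasserstein

variable {X : Type*} [MetricSpace X] [SecondCountableTopology X] [MeasurableSpace X]
  [BorelSpace X] {p : ℝ}

instance (μ : WassersteinSpace X p) : IsProbabilityMeasure (μ.toProb : Measure X) :=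
  μ.toProb.2

theorem WassersteinSpace.toMeasure_injective {X : Type*} [EDist X] [MeasurableSpace X] {p : ℝ}
    {μ ν : WassersteinSpace X p} (h : (μ.toProb : Measure X) = ν.toProb) : μ = ν :=
  WassersteinSpace.ext (Subtype.ext h)

/-- The Wasserstein distance is at most the `L^p`-distance of any coupling. -/
theorem wassersteinDist_le_lpEDist {Ω : Type*} [MeasurableSpace Ω] {P : Measure Ω}
    [IsProbabilityMeasure P] (hp : 1 ≤ p) {f g : Ω → X} (hf : Measurable f) (hg : Measurable g)
    {μ ν : WassersteinSpace X p} (hμ : P.map f = μ.toProb) (hν : P.map g = ν.toProb) :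
    wassersteinDist μ ν ≤ lpEDist p P f g := by
  have hfg : Measurable fun ω => (f ω, g ω) := hf.prodMk hg
  have : 0 ≤ 1 / p := by positivity
  have : IsProbabilityMeasure (P.map fun ω => (f ω, g ω)) :=
    Measure.isProbabilityMeasure_map hfg.aemeasurable
  refine ENNReal.rpow_le_rpow
    (iInf₂_le_of_le ⟨P.map fun ω => (f ω, g ω), this⟩ ⟨?_, ?_⟩ ?_) ‹_›
  · rw [← hμ]; exact Measure.map_map measurable_fst hfg
  · rw [← hν]; exact Measure.map_map measurable_snd hfg
  · exact (lintegral_map ((measurable_fst.edist measurable_snd).pow_const p) hfg).le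

theorem lpEDist_const_lt_top (hp : 1 ≤ p) {Ω : Type*} [MeasurableSpace Ω] {P : Measure Ω}
    {f : Ω → X} (hf : Measurable f) {μ : WassersteinSpace X p} (hμ : P.map f = μ.toProb) (x : X) :
    lpEDist p P (fun _ => x) f < ∞ := by
  rw [lpEDist_lt_top_iff hp, ← lintegral_map (f := fun y => edist x y ^ p)
    ((measurable_const.edist measurable_id).pow_const p) hf, hμ]
  exact μ.finite_moment x

/-- The law of a random variable with finite moment of order `p`. -/
noncomputable def law {Ω : Type*} [MeasurableSpace Ω] (P : Measure Ω) [IsProbabilityMeasure P] (hp : 1 ≤ p)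
    {f : Ω → X} (hf : Measurable f) (h : ∀ x, lpEDist p P (fun _ => x) f < ∞) :
    WassersteinSpace X p where
  toProb := ⟨P.map f, Measure.isProbabilityMeasure_map hf.aemeasurable⟩
  finite_moment x := by
    have := h x
    rw [lpEDist_lt_top_iff hp] at this
    exact (lintegral_map ((measurable_const.edist measurable_id).pow_const p) hf).trans_lt this

theorem wassersteinDist_self (hp : 1 ≤ p) (μ : WassersteinSpace X p) :
    wassersteinDist μ μ = 0 := by
  refine le_antisymm ?_ zero_le
  refine (wassersteinDist_le_lpEDist hp measurable_id measurable_id Measure.map_id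
    Measure.map_id).trans (lpEDist_self hp _).le

theorem wassersteinDist_comm (hp : 1 ≤ p) (μ ν : WassersteinSpace X p) :
    wassersteinDist μ ν = wassersteinDist ν μ := by
  suffices ∀ μ ν : WassersteinSpace X p, wassersteinDist μ ν ≤ wassersteinDist ν μ from
    le_antisymm (this _ _) (this _ _)
  refine fun μ ν => le_of_forall_gt fun c hc => ?_
  obtain ⟨γ, _, h1, h2, h⟩ := exists_plan_of_wassersteinDist_lt hp hc
  refine (wassersteinDist_le_lpEDist hp measurable_snd measurable_fst h2 h1).trans_lt ?_
  rwa [lpEDist_comm]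

theorem wassersteinDist_lt_top (hp : 1 ≤ p) (μ ν : WassersteinSpace X p) :
    wassersteinDist μ ν < ∞ := by
  obtain ⟨x⟩ := nonempty_of_isProbabilityMeasure (μ.toProb : Measure X)
  have h1 : ((μ.toProb : Measure X).prod (ν.toProb : Measure X)).map Prod.fst = μ.toProb :=
    Measure.fst_prod
  have h2 : ((μ.toProb : Measure X).prod (ν.toProb : Measure X)).map Prod.snd = ν.toProb :=
    Measure.snd_prod
  refine (wassersteinDist_le_lpEDist hp measurable_fst measurable_snd h1 h2).trans_lt ?_
  refine (lpEDist_triangle hp measurable_fst (measurable_const (a := x)) measurable_snd).trans_lt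
    (ENNReal.add_lt_top.2 ⟨?_, lpEDist_const_lt_top hp measurable_snd h2 x⟩)
  rw [lpEDist_comm]
  exact lpEDist_const_lt_top hp measurable_fst h1 x

/-- Plans of arbitrarily small cost put little mass far from the diagonal, by Markov's inequality.
Hence the Lévy–Prokhorov distance vanishes, and the measures agree on closed sets. -/
theorem eq_of_wassersteinDist_eq_zero (hp : 1 ≤ p) {μ ν : WassersteinSpace X p}
    (h : wassersteinDist μ ν = 0) : μ = ν := by
  apply WassersteinSpace.toMeasure_injective
  have hLP : levyProkhorovEDist (μ.toProb : Measure X) ν.toProb = 0 := by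
    refine le_antisymm (levyProkhorovEDist_le_of_forall_le _ _ 0 fun ε B hε hε' hB => ?_) zero_le
    have hp' : 0 < p := by linarith
    have hεp : ε ^ p ≠ 0 := by simp [ENNReal.rpow_eq_zero_iff, hε.ne', hε'.ne]
    have hεp' : ε ^ p ≠ ∞ := by simp [ENNReal.rpow_eq_top_iff, hε.ne', hε'.ne, hp'.not_gt]
    -- A cost below `ε * ε ^ p` leaves mass at most `ε` on `{ε ≤ d}` after Markov's division by `ε ^
    -- p`.
    have hc : wassersteinDist μ ν < (ε * ε ^ p) ^ p⁻¹ := by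
      rw [h, pos_iff_ne_zero]
      simp [ENNReal.rpow_eq_zero_iff, hε.ne', hεp, hp', hp'.not_gt]
    obtain ⟨γ, _, h1, h2, hγ⟩ := exists_plan_of_wassersteinDist_lt hp hc
    rw [lpEDist_lt_iff hp, ENNReal.rpow_inv_rpow hp'.ne'] at hγ
    rw [← h1, ← h2, Measure.fst_apply hB, Measure.snd_apply Metric.isOpen_thickening.measurableSet]
    calc γ (Prod.fst ⁻¹' B)
        ≤ γ (Prod.snd ⁻¹' Metric.thickening ε.toReal B ∪ {z | ε ≤ edist z.1 z.2}) := by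
          refine measure_mono fun z hz => or_iff_not_imp_right.2 fun hz' => ?_
          refine (Metric.mem_thickening_iff_exists_edist_lt _ _).2 ⟨z.1, hz, ?_⟩
          rw [ENNReal.ofReal_toReal hε'.ne, edist_comm]
          exact not_le.1 hz'
      _ ≤ _ := measure_union_le _ _
      _ ≤ _ := by
          gcongr
          refine (measure_le_edist_le hp measurable_fst measurable_snd hε.ne' hε'.ne).trans ?_
          rw [ENNReal.div_le_iff hεp hεp']
          exact hγ.le
  refine ext_of_generate_finite _ ?_ isPiSystem_isClosed (fun A hA => ?_) (by simp)
  · rw [BorelSpace.measurable_eq (α := X), borel_eq_generateFrom_isClosed]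
  · exact measure_eq_measure_of_levyProkhorovEDist_eq_zero_of_isClosed hLP hA
      ⟨1, one_pos, measure_ne_top _ _⟩ ⟨1, one_pos, measure_ne_top _ _⟩

end Wasserstein

/-! ### Triangle inequality, completeness and separability. -/

section Polish

variable {X : Type*} [MetricSpace X] [SecondCountableTopology X] [CompleteSpace X]
  [MeasurableSpace X] [BorelSpace X] {p : ℝ}

/-- Random variables realising a sequence of measures, whose consecutive `L^p`-distances are
controlled by the Wasserstein distances. -/
theorem exists_process_of_wassersteinDist_lt (hp : 1 ≤ p) (μ : ℕ → WassersteinSpace X p)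
    (c : ℕ → ℝ≥0∞) (h : ∀ n, wassersteinDist (μ n) (μ (n + 1)) < c n) :
    ∃ P : Measure (ℕ → X), IsProbabilityMeasure P ∧ (∀ n, P.map (fun x => x n) = (μ n).toProb) ∧
      ∀ n, lpEDist p P (fun x => x n) (fun x => x (n + 1)) < c n := by
  choose γ hγ h1 h2 hc using fun n => exists_plan_of_wassersteinDist_lt hp (h n)
  obtain ⟨P, hP, hPγ⟩ := exists_process_of_chain γ fun n => (h2 n).trans (h1 (n + 1)).symm
  have hm (n : ℕ) : Measurable fun x : ℕ → X => (x n, x (n + 1)) := by fun_prop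
  refine ⟨P, hP, fun n => ?_, fun n => ?_⟩
  · rw [← h1, ← hPγ, Measure.fst, Measure.map_map measurable_fst (hm n)]
    rfl
  · refine lt_of_eq_of_lt ?_ (hc n)
    rw [← hPγ, lpEDist_map (hm n) measurable_fst measurable_snd]
    rfl

theorem wassersteinDist_triangle (hp : 1 ≤ p) (μ ν ρ : WassersteinSpace X p) :
    wassersteinDist μ ρ ≤ wassersteinDist μ ν + wassersteinDist ν ρ := by
  refine le_of_forall_gt_imp_ge_of_dense fun c hc => ?_
  obtain ⟨a, ha, b, hb, hab⟩ := ENNReal.exists_add_lt_of_add_lt hc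
  -- The chain is constant from index 2 on, so any positive bound serves there.
  let u : ℕ → WassersteinSpace X p := fun n => if n = 0 then μ else if n = 1 then ν else ρ
  obtain ⟨P, hP, h1, h2⟩ := exists_process_of_wassersteinDist_lt hp u
    (fun n => if n = 0 then a else if n = 1 then b else 1) (by
      intro n
      rcases n with _ | _ | n
      · simpa [u] using ha
      · simpa [u] using hb
      · simp [u, wassersteinDist_self hp])
  refine (wassersteinDist_le_lpEDist hp (measurable_pi_apply 0) (measurable_pi_apply 2)
    (h1 0) (h1 2)).trans ?_
  exact ((lpEDist_triangle hp (measurable_pi_apply 0) (measurable_pi_apply 1)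
    (measurable_pi_apply 2)).trans (add_le_add (h2 0).le (h2 1).le)).trans hab.le

/-- The Wasserstein distance is a metric. -/
@[reducible]
noncomputable def wassersteinEMetricSpace (X : Type*) [MetricSpace X] [SecondCountableTopology X]
    [CompleteSpace X] [MeasurableSpace X] [BorelSpace X] {p : ℝ} (hp : 1 ≤ p) :
    EMetricSpace (WassersteinSpace X p) where
  edist_self := wassersteinDist_self hp
  edist_comm := wassersteinDist_comm hp
  edist_triangle := wassersteinDist_triangle hp
  eq_of_edist_eq_zero := eq_of_wassersteinDist_eq_zero hp

/-- The Wasserstein space as a metric space, the Wasserstein distance being finite. -/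
@[reducible]
noncomputable def wassersteinMetricSpace (X : Type*) [MetricSpace X] [SecondCountableTopology X]
    [CompleteSpace X] [MeasurableSpace X] [BorelSpace X] {p : ℝ} (hp : 1 ≤ p) :
    MetricSpace (WassersteinSpace X p) :=
  letI := wassersteinEMetricSpace X hp
  EMetricSpace.toMetricSpace fun μ ν => (wassersteinDist_lt_top hp μ ν).ne

/-- For a fast Cauchy sequence, the glued process has increments of finite total mean, so it
converges almost surely; the law of its limit is the limit of the sequence. -/
theorem wasserstein_completeSpace (hp : 1 ≤ p) :
    @CompleteSpace (WassersteinSpace X p) (wassersteinMetricSpace X hp).toUniformSpace := by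
  let := wassersteinMetricSpace X hp
  refine EMetric.complete_of_convergent_controlled_sequences (fun n => 2⁻¹ ^ n)
    (fun n => ENNReal.pow_pos (by simp) n) fun μ hμ => ?_
  obtain ⟨P, hP, hlaw, hd⟩ := exists_process_of_wassersteinDist_lt hp μ (fun n => 2⁻¹ ^ n)
    fun n => hμ n n (n + 1) le_rfl n.le_succ
  have hm (n : ℕ) : Measurable fun x : ℕ → X => x n := measurable_pi_apply n
  have hcauchy : ∀ᵐ x ∂P, ∃ y, Tendsto x atTop (𝓝 y) := by
    have hint : ∫⁻ x, ∑' n, edist (x n) (x (n + 1)) ∂P ≠ ∞ := by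
      rw [lintegral_tsum fun n => ((hm n).edist (hm (n + 1))).aemeasurable]
      refine ne_top_of_le_ne_top ?_ (ENNReal.tsum_le_tsum fun n =>
        (lintegral_edist_le_lpEDist hp (hm n) (hm (n + 1))).trans (hd n).le)
      simp [ENNReal.tsum_geometric]
    filter_upwards [ae_lt_top (by fun_prop) hint] with x hx
    exact cauchySeq_tendsto_of_complete
      (cauchySeq_of_edist_le_of_tsum_ne_top _ (fun n => le_rfl) hx.ne)
  obtain ⟨Y, hY, hYlim⟩ := measurable_limit_of_tendsto_metrizable_ae
    (fun n => (hm n).aemeasurable) hcauchy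
  -- Keeping the geometric tail on the left lets each new increment be absorbed in the induction.
  have hbound (n k : ℕ) :
      lpEDist p P (fun x => x n) (fun x => x (n + k)) + 2 * 2⁻¹ ^ (n + k) ≤ 2 * 2⁻¹ ^ n := by
    induction k with
    | zero => simp [lpEDist_self hp]
    | succ k ih =>
      refine le_trans ?_ ih
      have h2 : (2 : ℝ≥0∞) * 2⁻¹ ^ (n + (k + 1)) = 2⁻¹ ^ (n + k) := by
        rw [← add_assoc, pow_succ', ← mul_assoc, ENNReal.mul_inv_cancel (by simp) (by simp),
          one_mul]
      rw [h2, two_mul, ← add_assoc (lpEDist _ _ _ _)]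
      exact add_le_add_left ((lpEDist_triangle hp (hm n) (hm (n + k)) (hm (n + (k + 1)))).trans
        (add_le_add le_rfl (hd (n + k)).le)) _
  have hlim (n : ℕ) : lpEDist p P (fun x => x n) Y ≤ 2 * 2⁻¹ ^ n := by
    refine lpEDist_le_of_tendsto hp hm (hm n) hYlim ?_
    filter_upwards [eventually_ge_atTop n] with m hmn
    obtain ⟨k, rfl⟩ := Nat.exists_eq_add_of_le hmn
    exact le_self_add.trans (hbound n k)
  have hmom (x : X) : lpEDist p P (fun _ => x) Y < ∞ := by
    refine (lpEDist_triangle hp measurable_const (hm 0) hY).trans_lt (ENNReal.add_lt_top.2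
      ⟨lpEDist_const_lt_top hp (hm 0) (hlaw 0) x, (hlim 0).trans_lt (by simp)⟩)
  refine ⟨law P hp hY hmom, tendsto_iff_edist_tendsto_0.2 ?_⟩
  have h0 : Tendsto (fun n : ℕ => (2 : ℝ≥0∞) * 2⁻¹ ^ n) atTop (𝓝 0) := by
    have := ENNReal.Tendsto.const_mul (a := 2)
      (ENNReal.tendsto_pow_atTop_nhds_zero_of_lt_one (r := 2⁻¹) (by simp))
      (Or.inr (by simp))
    simpa using this
  exact tendsto_of_tendsto_of_tendsto_of_le_of_le tendsto_const_nhds h0 (fun _ => zero_le)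
    fun n => (wassersteinDist_le_lpEDist hp (hm n) hY (hlaw n) rfl).trans (hlim n)

/-- A separable metric space embeds isometrically into a separable normed space. -/
theorem exists_isometry_to_separable_normedSpace (X : Type*) [MetricSpace X] [SeparableSpace X] :
    ∃ (E : Type) (_ : NormedAddCommGroup E) (_ : NormedSpace ℝ E) (_ : SeparableSpace E)
      (ι : X → E), Isometry ι := by
  let V := Submodule.span ℝ (Set.range (kuratowskiEmbedding X))
  have hV : IsSeparable (V : Set (lp (fun _ : ℕ => ℝ) ∞)) :=
    (isSeparable_range (kuratowskiEmbedding.isometry X).continuous).span (R := ℝ)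
  refine ⟨V, inferInstance, inferInstance, hV.separableSpace,
    fun x => ⟨kuratowskiEmbedding X x, Submodule.subset_span ⟨x, rfl⟩⟩, fun x y => ?_⟩
  exact kuratowskiEmbedding.isometry X x y

/-- Each measure is the law of some map on the unit interval. Sending it to that map, viewed in a
separable `L^p` space, does not decrease distances, so the inverse is a 1-Lipschitz surjection from
a separable set. -/
theorem wasserstein_separableSpace (hp : 1 ≤ p) :
    @SeparableSpace (WassersteinSpace X p)
      (wassersteinMetricSpace X hp).toUniformSpace.toTopologicalSpace := by
  let := wassersteinMetricSpace X hp
  obtain ⟨E, _, _, _, ι, hι⟩ := exists_isometry_to_separable_normedSpace X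
  have hp0 : 0 < p := by linarith
  have hpt : (ENNReal.ofReal p).toReal = p := ENNReal.toReal_ofReal hp0.le
  have hpz : ENNReal.ofReal p ≠ 0 := by simpa using hp0
  have : Fact (1 ≤ ENNReal.ofReal p) := ⟨by simpa using hp⟩
  have : Fact (ENNReal.ofReal p ≠ ∞) := ⟨ENNReal.ofReal_ne_top⟩
  have hnorm (f g : unitInterval → X) :
      eLpNorm (fun ω => ι (f ω) - ι (g ω)) (ENNReal.ofReal p) volume = lpEDist p volume f g := by
    rw [eLpNorm_eq_lintegral_rpow_enorm_toReal hpz ENNReal.ofReal_ne_top, hpt, lpEDist]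
    simp only [← hι.edist_eq, edist_eq_enorm_sub]
  have hX (μ : WassersteinSpace X p) : Nonempty X :=
    nonempty_of_isProbabilityMeasure (μ.toProb : Measure X)
  have hrep (μ : WassersteinSpace X p) :
      ∃ T : unitInterval → X, Measurable T ∧ volume.map T = μ.toProb := by
    have := hX μ
    exact Measure.exists_measurable_map_eq (μ.toProb : Measure X)
  choose T hT hTμ using hrep
  have hsm (f : unitInterval → X) (hf : Measurable f) :
      AEStronglyMeasurable (fun ω => ι (f ω)) volume :=
    (hι.continuous.comp_stronglyMeasurable hf.stronglyMeasurable).aestronglyMeasurable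
  have hmem (μ : WassersteinSpace X p) :
      -- The moment condition controls `ι ∘ T μ - ι x`; the constant is added back since the
      -- interval has finite measure.
      MemLp (fun ω => ι (T μ ω)) (ENNReal.ofReal p) volume := by
    obtain ⟨x⟩ := hX μ
    have h : MemLp (fun ω => ι (T μ ω) - ι x) (ENNReal.ofReal p) volume := by
      refine ⟨(hsm _ (hT μ)).sub aestronglyMeasurable_const, ?_⟩
      rw [hnorm _ fun _ => x, lpEDist_comm]
      exact lpEDist_const_lt_top hp (hT μ) (hTμ μ) x
    simpa [Pi.add_def] using h.add (memLp_const (ι x))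
  let Φ : WassersteinSpace X p → Lp E (ENNReal.ofReal p) (volume : Measure unitInterval) :=
    fun μ => (hmem μ).toLp _
  -- The pair `(T μ, T ν)` is a coupling, though not an optimal one.
  have hΦ : AntilipschitzWith 1 Φ := fun μ ν => by
    rw [ENNReal.coe_one, one_mul, Lp.edist_toLp_toLp]
    exact (wassersteinDist_le_lpEDist hp (hT μ) (hT ν) (hTμ μ) (hTμ ν)).trans (hnorm _ _).ge
  have hsurj : Function.Surjective fun y : Set.range Φ => y.2.choose := fun μ =>
    ⟨⟨Φ μ, μ, rfl⟩, hΦ.injective (Exists.choose_spec (p := fun ν => Φ ν = Φ μ) _)⟩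
  have hcont : Continuous fun y : Set.range Φ => y.2.choose := by
    refine LipschitzWith.continuous (K := 1) fun y z => ?_
    have h := hΦ y.2.choose z.2.choose
    rwa [y.2.choose_spec, z.2.choose_spec] at h
  exact hsurj.denseRange.separableSpace hcont

end Polish

end HierarchicalOT

theorem mainTheorem8 (X : Type*) [MetricSpace X] [CompleteSpace X]
    [TopologicalSpace.SeparableSpace X] [MeasurableSpace X] [BorelSpace X]
    (p : ℝ) (hp : 1 ≤ p) :
    HierarchicalOT.IsPolishMetric
      (HierarchicalOT.hierarchicalWassersteinDist :
        HierarchicalOT.HierarchicalWassersteinSpace X p →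
          HierarchicalOT.HierarchicalWassersteinSpace X p → ENNReal) := by
  have := UniformSpace.secondCountable_of_separable X
  let := HierarchicalOT.wassersteinMetricSpace X hp
  have := HierarchicalOT.wasserstein_completeSpace (X := X) hp
  have := HierarchicalOT.wasserstein_separableSpace (X := X) hp
  have := UniformSpace.secondCountable_of_separable (HierarchicalOT.WassersteinSpace X p)
  -- The σ-algebra was defined from `edistTopology`, before any metric axiom was known; it must be
  -- identified with the metric Borel σ-algebra before the second application.
  have : BorelSpace (HierarchicalOT.WassersteinSpace X p) :=
    ⟨congrArg (@borel _) (HierarchicalOT.edistTopology_eq _)⟩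
  refine ⟨HierarchicalOT.wassersteinMetricSpace (HierarchicalOT.WassersteinSpace X p) hp,
    fun φ ψ => ?_, HierarchicalOT.wasserstein_completeSpace hp,
    HierarchicalOT.wasserstein_separableSpace hp⟩
  let := HierarchicalOT.wassersteinMetricSpace (HierarchicalOT.WassersteinSpace X p) hp
  exact edist_dist φ ψ
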